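/- **Conventions.** A continuum is a connected compact Hausdorff space (non-empty); it is non-degenerate if it has more than one point. For a continuum $Y$ let $$\mathrm{Sln}(Y)=\sup\{|\mathcal C| : \mathcal C \text{ is a family of pairwise disjoint non-degenerate subcontinua of } Y\},$$ and for a Tychonov space $X$ let $\mathrm{Sln}(X)$ be the least cardinal $\mathrm{Sln}(Y)$, where $Y$ runs over all continua containing a homeomorphic copy of $X$ (for a continuum $X$ both definitions agree). The weight $w(X)$ is the least cardinality of a base of the topology of $X$. For a cardinal $\kappa$, $\kappa^+$ is its successor cardinal. A tree is a partially ordered set in which the set of predecessors of every element is well-ordered; the height of an element is the order type of the set of its predecessors, and the height of the tree is the least ordinal greater than the heights of all its elements. For a cardinal $\mu$ (identified with its initial ordinal), a $\mu$-Suslin tree is a tree of height $\mu$ that contains no chain and no antichain of cardinality $\mu$; an antichain is a set of pairwise incomparable elements. **Theorem.** Let $X$ be a Tychonov space and $\kappa=\mathrm{Sln}(X)$. Then $w(X)\le\kappa^+$. Moreover, if $X$ is not a one-point space and no $\kappa^+$-Suslin tree exists, then $w(X)\le\kappa$. -/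

import Mathlib

open Cardinal Ordinal Set Topology

universe u

namespace SuslinianNumber

section Topology

/-- The weight of a topological space: the least cardinality of a base of its topology. -/
noncomputable def weight (X : Type u) [TopologicalSpace X] : Cardinal.{u} :=
  sInf {κ : Cardinal.{u} | ∃ B : Set (Set X), TopologicalSpace.IsTopologicalBasis B ∧ #B = κ}

/-- A continuum: a connected compact Hausdorff space. -/
structure IsContinuum (Y : Type u) [TopologicalSpace Y] : Prop where
  compactSpace : CompactSpace Y
  t2Space : T2Space Y
  connectedSpace : ConnectedSpace Y

/-- A family of pairwise disjoint non-degenerate subcontinua of a (Hausdorff) space `Y`. -/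
structure IsDisjointContinuumFamily {Y : Type u} [TopologicalSpace Y] (𝒞 : Set (Set Y)) :
    Prop where
  isCompact : ∀ C ∈ 𝒞, IsCompact C
  isConnected : ∀ C ∈ 𝒞, IsConnected C
  nontrivial : ∀ C ∈ 𝒞, C.Nontrivial
  pairwiseDisjoint : 𝒞.PairwiseDisjoint id

/-- The Suslinian number of a continuum `Y`: the supremum of the cardinalities of families of
pairwise disjoint non-degenerate subcontinua of `Y`. -/
noncomputable def continuumSln (Y : Type u) [TopologicalSpace Y] : Cardinal.{u} :=
  ⨆ 𝒞 : {𝒞 : Set (Set Y) // IsDisjointContinuumFamily 𝒞}, #(𝒞 : Set (Set Y))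

/-- The Suslinian numbers of all continua that contain a homeomorphic copy of `X`. -/
def slnSet (X : Type u) [TopologicalSpace X] : Set Cardinal.{u} :=
  {κ | ∃ (Y : Type u) (_ : TopologicalSpace Y),
    IsContinuum Y ∧ (∃ f : X → Y, IsEmbedding f) ∧ continuumSln Y = κ}

/-- The Suslinian number of a Tychonov space `X`: the least Suslinian number of a continuum
containing `X`. -/
noncomputable def Sln (X : Type u) [TopologicalSpace X] : Cardinal.{u} :=
  sInf (slnSet X)

/-- The supremum that defines `continuumSln` is a genuine one. -/
theorem bddAbove_continuumSln (Y : Type u) [TopologicalSpace Y] :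
    BddAbove (range fun 𝒞 : {𝒞 : Set (Set Y) // IsDisjointContinuumFamily 𝒞} =>
      #(𝒞 : Set (Set Y))) :=
  Cardinal.bddAbove_of_small

/-- Every Tychonov space embeds into a continuum (a cube), so the minimum that defines `Sln` is
taken over a non-empty set. -/
theorem slnSet_nonempty (X : Type u) [TopologicalSpace X] [T35Space X] :
    (slnSet X).Nonempty := by
  let e : StoneCech X → C(StoneCech X, unitInterval) → unitInterval := fun x g => g x
  have he : Continuous e := continuous_pi fun g => g.continuous
  have hinj : Function.Injective e := by
    intro x y hxy
    by_contra hne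
    obtain ⟨g, hg, hgne⟩ := separatesPoints_continuous_of_t35Space_Icc hne
    exact hgne (congrFun hxy ⟨g, hg⟩)
  exact ⟨_, C(StoneCech X, unitInterval) → unitInterval, inferInstance,
    ⟨inferInstance, inferInstance, inferInstance⟩,
    ⟨e ∘ stoneCechUnit, (he.isClosedEmbedding hinj).isEmbedding.comp isEmbedding_stoneCechUnit⟩,
    rfl⟩

/-- On continua, `Sln` agrees with `continuumSln`. -/
theorem Sln_eq_continuumSln (X : Type u) [TopologicalSpace X] (hX : IsContinuum X) :
    Sln X = continuumSln X := by
  apply le_antisymm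
  · exact csInf_le' ⟨X, _, hX, ⟨id, IsEmbedding.id⟩, rfl⟩
  · refine le_csInf ⟨_, X, _, hX, ⟨id, IsEmbedding.id⟩, rfl⟩ ?_
    rintro κ ⟨Y, _, hY, ⟨f, hf⟩, rfl⟩
    refine ciSup_le' fun ⟨𝒞, h𝒞⟩ => ?_
    have hD : IsDisjointContinuumFamily (image f '' 𝒞) := by
      refine ⟨?_, ?_, ?_, ?_⟩
      · rintro _ ⟨C, hC, rfl⟩
        exact (h𝒞.isCompact C hC).image hf.continuous
      · rintro _ ⟨C, hC, rfl⟩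
        exact (h𝒞.isConnected C hC).image f hf.continuous.continuousOn
      · rintro _ ⟨C, hC, rfl⟩
        exact (h𝒞.nontrivial C hC).image hf.injective
      · rintro _ ⟨C, hC, rfl⟩ _ ⟨D, hD, rfl⟩ hne
        have hCD : C ≠ D := fun h => hne (h ▸ rfl)
        exact (disjoint_image_iff hf.injective).2 (h𝒞.pairwiseDisjoint hC hD hCD)
    have h := le_ciSup (bddAbove_continuumSln Y) ⟨_, hD⟩
    rwa [mk_image_eq hf.injective.image_injective] at h

end Topology

section Trees

/-- A tree: a partially ordered set in which the predecessors of each element are well-ordered. -/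
class IsTree (T : Type u) [PartialOrder T] : Prop where
  isWellOrder_Iio : ∀ t : T, IsWellOrder (Iio t) (· < ·)

attribute [instance] IsTree.isWellOrder_Iio

/-- The height of an element of a tree: the order type of the set of its predecessors. -/
noncomputable def nodeHeight {T : Type u} [PartialOrder T] [IsTree T] (t : T) : Ordinal.{u} :=
  Ordinal.type (fun a b : Iio t => a < b)

/-- The height of a tree: the least ordinal greater than the heights of all its elements,
that is, the least ordinal `α` such that the `α`-th level is empty. -/
noncomputable def treeHeight (T : Type u) [PartialOrder T] [IsTree T] : Ordinal.{u} :=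
  sInf {α : Ordinal.{u} | ∀ t : T, nodeHeight t < α}

/-- A `μ`-Suslin tree: a tree of height `μ` with no chain and no antichain of cardinality `μ`. -/
structure IsSuslinTree (μ : Cardinal.{u}) (T : Type u) [PartialOrder T] [IsTree T] : Prop where
  height_eq : treeHeight T = μ.ord
  chain : ∀ C : Set T, IsChain (· ≤ ·) C → #C ≠ μ
  antichain : ∀ A : Set T, IsAntichain (· ≤ ·) A → #A ≠ μ

/-- Some `μ`-Suslin tree exists. -/
def ExistsSuslinTree (μ : Cardinal.{u}) : Prop :=
  ∃ (T : Type u) (_ : PartialOrder T) (_ : IsTree T), IsSuslinTree μ T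

end Trees

end SuslinianNumber

/-! Embed `X` in a continuum `Y` with Suslinian number `κ`; a non-degenerate `Y` forces `κ` to be
infinite. For a set `S` of real functions on `Y`, consider the components of the fibres of its
diagonal map. The non-degenerate ones ("nodes") are disjoint continua, so there are at most `κ` of
them. Adding for each node a function that is not constant on it splits them all; iterate along
`κ⁺`.

Nodes of all stages form a tree under reverse inclusion. Antichains are disjoint families, hence of
size at most `κ`. So are chains (`mk_le_of_strictAnti`): by boundary bumping, each difference of
consecutive continua contains a non-degenerate continuum, and these are disjoint. Hence the
functions of all `κ⁺` stages together leave no node. If every single stage has a node, the tree is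
`κ⁺`-Suslin; otherwise at most `κ` functions already leave none.

A set `S` without nodes defines a light map, and then the weight of `Y` is at most any infinite
cardinal bounding both `S` and `κ` (`weight_le_of_light`). -/

namespace SuslinianNumber

/-! ### Boundary bumping and disjoint families of subcontinua -/

section BoundaryBumping

variable {X : Type u} [TopologicalSpace X]

theorem isClosed_connectedComponentIn {F : Set X} (hF : IsClosed F) (x : X) :
    IsClosed (connectedComponentIn F x) := by
  by_cases h : x ∈ F
  · rw [connectedComponentIn_eq_image h]
    exact hF.isClosedEmbedding_subtypeVal.isClosedMap _ isClosed_connectedComponent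
  · rw [connectedComponentIn_eq_empty h]
    exact isClosed_empty

/-- Boundary bumping: in a continuum, the component of an interior point of a proper closed set
is non-degenerate. -/
theorem nontrivial_connectedComponentIn [CompactSpace X] [T2Space X] [PreconnectedSpace X]
    {F : Set X} (hF : IsClosed F) (hne : F ≠ Set.univ) {x : X} (hx : x ∈ interior F) :
    (connectedComponentIn F x).Nontrivial := by
  by_contra h
  rw [not_nontrivial_iff] at h
  have hxF : x ∈ F := interior_subset hx
  have : CompactSpace F := isCompact_iff_compactSpace.1 hF.isCompact
  rw [connectedComponentIn_eq_image hxF] at h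
  -- In the compact Hausdorff space `F` a component is the intersection of the clopen sets around
  -- it, so by compactness some clopen `Z` around `x` lies in the interior of `F`.
  have hsub : (⋂ Z : {Z : Set F // IsClopen Z ∧ (⟨x, hxF⟩ : F) ∈ Z}, (Z : Set F)) ⊆
      Subtype.val ⁻¹' interior F := by
    rw [← connectedComponent_eq_iInter_isClopen]
    intro y hy
    have : (y : X) = x := h (mem_image_of_mem _ hy) (mem_image_of_mem _ mem_connectedComponent)
    rwa [mem_preimage, this]
  have : Nonempty {Z : Set F // IsClopen Z ∧ (⟨x, hxF⟩ : F) ∈ Z} :=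
    ⟨⟨Set.univ, isClopen_univ, mem_univ _⟩⟩
  obtain ⟨⟨Z, hZ, hxZ⟩, hZF⟩ := exists_subset_nhds_of_compactSpace
    (V := fun Z : {Z : Set F // IsClopen Z ∧ (⟨x, hxF⟩ : F) ∈ Z} => (Z : Set F))
    (fun A B => ⟨⟨A ∩ B, A.2.1.inter B.2.1, A.2.2, B.2.2⟩, inter_subset_left,
      inter_subset_right⟩) (fun Z => Z.2.1.1)
    (fun y hy => (isOpen_interior.preimage continuous_subtype_val).mem_nhds (hsub hy))
  obtain ⟨W, hW, rfl⟩ := isOpen_induced_iff.1 hZ.2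
  have hEq : Subtype.val '' (Subtype.val ⁻¹' W : Set F) = W ∩ interior F := by
    ext y
    constructor
    · rintro ⟨z, hz, rfl⟩
      exact ⟨hz, hZF hz⟩
    · rintro ⟨hy, hyF⟩
      exact ⟨⟨y, interior_subset hyF⟩, hy, rfl⟩
  -- Closed because `F` is closed, open as an intersection of open sets; connectedness of `X` then
  -- forces `F` to be everything.
  have hclopen : IsClopen (W ∩ interior F) :=
    ⟨hEq ▸ hF.isClosedEmbedding_subtypeVal.isClosedMap _ hZ.1, hW.inter isOpen_interior⟩
  have huniv := hclopen.eq_univ ⟨x, hxZ, hx⟩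
  exact hne (eq_univ_of_univ_subset
    ((huniv ▸ inter_subset_right : Set.univ ⊆ interior F).trans interior_subset))

/-- A continuum that is not covered by a closed set `L` contains a non-degenerate subcontinuum
that misses `L`. -/
theorem exists_subcontinuum_disjoint [T2Space X] {K L : Set X} (hK : IsCompact K)
    (hKc : IsPreconnected K) (hKn : K.Nontrivial) (hL : IsClosed L) (h : ¬ K ⊆ L) :
    ∃ D ⊆ K, IsCompact D ∧ IsConnected D ∧ D.Nontrivial ∧ Disjoint D L := by
  obtain ⟨x, hxK, hxL⟩ := not_subset.1 h
  have : CompactSpace K := isCompact_iff_compactSpace.1 hK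
  have : PreconnectedSpace K := Subtype.preconnectedSpace hKc
  obtain ⟨y, hyK, hyx⟩ := hKn.exists_ne x
  -- Removing `y` as well keeps `F` proper in `K`, as boundary bumping requires.
  have hU : IsOpen ((Subtype.val ⁻¹' L)ᶜ ∩ {⟨y, hyK⟩}ᶜ : Set K) :=
    (hL.preimage continuous_subtype_val).isOpen_compl.inter isClosed_singleton.isOpen_compl
  obtain ⟨F, hF, hFc, hFU⟩ := exists_mem_nhds_isClosed_subset
    (hU.mem_nhds (x := ⟨x, hxK⟩) ⟨hxL, fun h => hyx (congrArg Subtype.val h).symm⟩)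
  have hFne : F ≠ Set.univ := fun h => (hFU (h ▸ mem_univ (⟨y, hyK⟩ : K))).2 rfl
  have hx : (⟨x, hxK⟩ : K) ∈ interior F := mem_interior_iff_mem_nhds.2 hF
  refine ⟨Subtype.val '' connectedComponentIn F ⟨x, hxK⟩, ?_, ?_, ?_, ?_, ?_⟩
  · rintro _ ⟨z, -, rfl⟩
    exact z.2
  · exact (isClosed_connectedComponentIn hFc _).isCompact.image continuous_subtype_val
  · exact (isConnected_connectedComponentIn_iff.2 (interior_subset hx)).image _
      continuous_subtype_val.continuousOn
  · exact (nontrivial_connectedComponentIn hFc hFne hx).image Subtype.val_injective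
  · rw [disjoint_left]
    rintro _ ⟨z, hz, rfl⟩ hzL
    exact (hFU (connectedComponentIn_subset _ _ hz)).1 hzL

/-- A family of non-degenerate continua `K i`, each with a proper part `L i` such that for any
two indices one `K` lies in the other `L`, gives rise to a disjoint family of the same size. -/
theorem mk_le_of_subset_or_subset [T2Space X] {κ : Cardinal.{u}}
    (hκ : ∀ 𝒞 : Set (Set X), IsDisjointContinuumFamily 𝒞 → #𝒞 ≤ κ)
    {ι : Type u} (K L : ι → Set X) (hK : ∀ i, IsCompact (K i)) (hKc : ∀ i, IsPreconnected (K i))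
    (hKn : ∀ i, (K i).Nontrivial) (hL : ∀ i, IsClosed (L i)) (hKL : ∀ i, ¬ K i ⊆ L i)
    (h : ∀ i j, i ≠ j → K i ⊆ L j ∨ K j ⊆ L i) : #ι ≤ κ := by
  choose D hDK hD hDc hDn hDL using fun i =>
    exists_subcontinuum_disjoint (hK i) (hKc i) (hKn i) (hL i) (hKL i)
  have hdisj : ∀ i j, i ≠ j → Disjoint (D i) (D j) := by
    intro i j hij
    rcases h i j hij with h | h
    · exact (hDL j).symm.mono_left ((hDK i).trans h)
    · exact (hDL i).mono_right ((hDK j).trans h)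
  have hinj : Function.Injective D := by
    intro i j hij
    by_contra hne
    obtain ⟨x, hx⟩ := (hDn i).nonempty
    exact disjoint_left.1 (hdisj i j hne) hx (hij ▸ hx)
  rw [← mk_range_eq D hinj]
  refine hκ _ ⟨?_, ?_, ?_, ?_⟩
  · rintro _ ⟨i, rfl⟩
    exact hD i
  · rintro _ ⟨i, rfl⟩
    exact hDc i
  · rintro _ ⟨i, rfl⟩
    exact hDn i
  · rintro _ ⟨i, rfl⟩ _ ⟨j, rfl⟩ hne
    exact hdisj i j fun h => hne (h ▸ rfl)

/-- A non-degenerate continuum contains infinitely many disjoint non-degenerate subcontinua. -/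
theorem aleph0_le_of_nontrivial [CompactSpace X] [T2Space X] [PreconnectedSpace X] [Nontrivial X]
    {κ : Cardinal.{u}} (hκ : ∀ 𝒞 : Set (Set X), IsDisjointContinuumFamily 𝒞 → #𝒞 ≤ κ) :
    ℵ₀ ≤ κ := by
  let P := {K : Set X // IsCompact K ∧ IsPreconnected K ∧ K.Nontrivial}
  have hstep : ∀ K : P, ∃ K' : P, K'.1 ⊂ K.1 := by
    rintro ⟨K, hK, hKc, hKn⟩
    obtain ⟨x, hx, y, hy, hxy⟩ := hKn
    obtain ⟨D, hDK, hD, hDc, hDn, hDy⟩ := exists_subcontinuum_disjoint hK hKc ⟨x, hx, y, hy, hxy⟩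
      (isClosed_singleton (x := y)) fun h => hxy (h hx)
    exact ⟨⟨D, hD, hDc.isPreconnected, hDn⟩, hDK, fun h => disjoint_left.1 hDy (h hy) rfl⟩
  choose f hf using hstep
  let K : ℕ → P := fun n => f^[n] ⟨Set.univ, isCompact_univ, isPreconnected_univ, nontrivial_univ⟩
  have hK : ∀ n, (K (n + 1)).1 ⊂ (K n).1 := fun n => by
    simp only [K, Function.iterate_succ_apply']
    exact hf _
  have hanti : Antitone fun n => (K n).1 := antitone_nat_of_succ_le fun n => (hK n).subset
  have := mk_le_of_subset_or_subset hκ (ι := ULift.{u} ℕ) (fun n => (K n.down).1)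
    (fun n => (K (n.down + 1)).1) (fun n => (K _).2.1) (fun n => (K _).2.2.1)
    (fun n => (K _).2.2.2) (fun n => (K _).2.1.isClosed) (fun n => (hK n.down).not_subset)
    (by
      rintro ⟨m⟩ ⟨n⟩ hmn
      rcases lt_or_gt_of_ne (show m ≠ n from fun h => hmn (h ▸ rfl)) with h | h
      · exact Or.inr (hanti h)
      · exact Or.inl (hanti h))
  simpa using this

/-- A strictly decreasing well-ordered chain of continua has at most `κ` elements. -/
theorem mk_le_of_strictAnti [T2Space X] {κ : Cardinal.{u}} (hκ₀ : ℵ₀ ≤ κ)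
    (hκ : ∀ 𝒞 : Set (Set X), IsDisjointContinuumFamily 𝒞 → #𝒞 ≤ κ)
    {I : Type u} [LinearOrder I] [WellFoundedLT I] (K : I → Set X) (hanti : StrictAnti K)
    (hK : ∀ i, IsCompact (K i)) (hKc : ∀ i, IsPreconnected (K i))
    (hKn : ∀ i, (K i).Nontrivial) : #I ≤ κ := by
  -- Each index is paired with its successor, so `L` is the next continuum of the chain. A maximal
  -- index has none, but there is at most one and `κ` is infinite.
  have hnext : ∀ i : {i : I // ¬ IsMax i}, ∃ j, i.1 < j ∧ ∀ k, i.1 < k → j ≤ k := by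
    rintro ⟨i, hi⟩
    obtain ⟨j, hj⟩ := not_isMax_iff.1 hi
    have hne : (Ioi i).Nonempty := ⟨j, hj⟩
    exact ⟨wellFounded_lt.min (Ioi i) hne, wellFounded_lt.min_mem _ hne,
      fun k hk => wellFounded_lt.min_le hk⟩
  choose s hs hs' using hnext
  have h₁ : #{i : I // ¬ IsMax i} ≤ κ := by
    refine mk_le_of_subset_or_subset hκ (fun i => K i.1) (fun i => K (s i)) (fun i => hK _)
      (fun i => hKc _) (fun i => hKn _) (fun i => (hK _).isClosed)
      (fun i => (hanti (hs i)).not_ge) fun i j hij => ?_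
    rcases lt_or_gt_of_ne (fun h => hij (Subtype.ext h) : i.1 ≠ j.1) with h | h
    · exact Or.inr (hanti.antitone (hs' i _ h))
    · exact Or.inl (hanti.antitone (hs' j _ h))
  have h₂ : #{i : I // IsMax i} ≤ 1 := by
    rw [le_one_iff_subsingleton]
    exact ⟨fun i j => Subtype.ext
      (le_antisymm (j.2.isTop i.1) (i.2.isTop j.1))⟩
  calc #I = #{i : I // IsMax i} + #{i : I // ¬ IsMax i} := (mk_sum_compl {i : I | IsMax i}).symm
    _ ≤ 1 + κ := add_le_add h₂ h₁
    _ = κ := Cardinal.add_eq_right hκ₀ (one_le_aleph0.trans hκ₀)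

end BoundaryBumping

/-! ### Light maps and weight -/

section Light

variable {X : Type u} [TopologicalSpace X]

theorem isDisjointContinuumFamily_components [CompactSpace X] [T2Space X] {F : Set X}
    (hF : IsClosed F) : IsDisjointContinuumFamily
      {K : Set X | ∃ x, K = connectedComponentIn F x ∧ K.Nontrivial} := by
  refine ⟨?_, ?_, fun K hK => ?_, ?_⟩
  · rintro _ ⟨x, rfl, -⟩
    exact (isClosed_connectedComponentIn hF x).isCompact
  · rintro _ ⟨x, rfl, h⟩
    exact ⟨h.nonempty, isPreconnected_connectedComponentIn⟩
  · obtain ⟨_, _, h⟩ := hK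
    exact h
  · rintro _ ⟨x, rfl, -⟩ _ ⟨y, rfl, -⟩ hne
    refine disjoint_left.2 fun z hx hy => hne ?_
    simp only [id] at hx hy
    rw [connectedComponentIn_eq hx, connectedComponentIn_eq hy]

/-- The fibre through `x` of the diagonal product of the functions in `S`. -/
def fiber (S : Set C(X, ℝ)) (x : X) : Set X := {y | ∀ g ∈ S, g y = g x}

theorem mem_fiber_self (S : Set C(X, ℝ)) (x : X) : x ∈ fiber S x := fun _ _ => rfl

theorem isClosed_fiber (S : Set C(X, ℝ)) (x : X) : IsClosed (fiber S x) := by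
  simp only [fiber, ofPred_forall]
  exact isClosed_biInter fun g _ => isClosed_eq g.continuous continuous_const

theorem fiber_eq_of_mem {S : Set C(X, ℝ)} {x y : X} (h : y ∈ fiber S x) :
    fiber S y = fiber S x := by
  ext z
  exact forall₂_congr fun g hg => by rw [h g hg]

theorem fiber_anti {S S' : Set C(X, ℝ)} (h : S ⊆ S') (x : X) : fiber S' x ⊆ fiber S x :=
  fun _ hy g hg => hy g (h hg)

/-- A basic open box defined by finitely many rational strict inequalities. -/
def openBox {S : Set C(X, ℝ)} (t : Finset (S × ℚ × ℚ)) : Set X :=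
  {y | ∀ p ∈ t, (p.2.1 : ℝ) < p.1.1 y ∧ p.1.1 y < (p.2.2 : ℝ)}

/-- A basic closed box defined by finitely many rational inequalities. -/
def closedBox {S : Set C(X, ℝ)} (t : Finset (S × ℚ × ℚ)) : Set X :=
  {y | ∀ p ∈ t, (p.2.1 : ℝ) ≤ p.1.1 y ∧ p.1.1 y ≤ (p.2.2 : ℝ)}

theorem isOpen_openBox {S : Set C(X, ℝ)} (t : Finset (S × ℚ × ℚ)) : IsOpen (openBox t) := by
  simp only [openBox, ofPred_forall]
  exact isOpen_biInter_finset fun p _ =>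
    (isOpen_lt continuous_const p.1.1.continuous).inter
      (isOpen_lt p.1.1.continuous continuous_const)

theorem isClosed_closedBox {S : Set C(X, ℝ)} (t : Finset (S × ℚ × ℚ)) :
    IsClosed (closedBox t) := by
  simp only [closedBox, ofPred_forall]
  exact isClosed_biInter fun p _ =>
    (isClosed_le continuous_const p.1.1.continuous).inter
      (isClosed_le p.1.1.continuous continuous_const)

theorem openBox_subset_closedBox {S : Set C(X, ℝ)} (t : Finset (S × ℚ × ℚ)) :
    openBox t ⊆ closedBox t :=
  fun _ hy p hp => ⟨(hy p hp).1.le, (hy p hp).2.le⟩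

/-- The closed boxes whose open box contains `x` are directed, and their intersection lies in the
fibre of `x`; compactness puts one of them inside `U`. -/
theorem exists_closedBox_subset [CompactSpace X] {S : Set C(X, ℝ)} {x : X} {U : Set X}
    (hU : IsOpen U) (h : fiber S x ⊆ U) :
    ∃ t : Finset (S × ℚ × ℚ), x ∈ openBox t ∧ closedBox t ⊆ U := by
  classical
  have : Nonempty {t : Finset (S × ℚ × ℚ) // x ∈ openBox t} :=
    ⟨⟨∅, fun p hp => absurd hp (Finset.notMem_empty p)⟩⟩
  have hfib : ∀ y ∈ ⋂ t : {t : Finset (S × ℚ × ℚ) // x ∈ openBox t}, closedBox t.1,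
      y ∈ fiber S x := by
    intro y hy g hg
    by_contra hne
    have key : ∀ a b : ℚ, (a : ℝ) < g x → g x < b → (a : ℝ) ≤ g y ∧ g y ≤ b := fun a b ha hb =>
      mem_iInter.1 hy ⟨{(⟨g, hg⟩, a, b)}, fun p hp => by
        rw [Finset.mem_singleton.1 hp]; exact ⟨ha, hb⟩⟩ (⟨g, hg⟩, a, b)
        (Finset.mem_singleton_self _)
    obtain ⟨a, ha⟩ := exists_rat_lt (g x)
    obtain ⟨b, hb⟩ := exists_rat_gt (g x)
    rcases lt_or_gt_of_ne hne with h | h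
    · obtain ⟨c, hc, hc'⟩ := exists_rat_btwn h
      exact absurd (key c b hc' hb).1 hc.not_ge
    · obtain ⟨c, hc, hc'⟩ := exists_rat_btwn h
      exact absurd (key a c ha hc).2 hc'.not_ge
  obtain ⟨t, ht⟩ := exists_subset_nhds_of_compactSpace
    (V := fun t : {t : Finset (S × ℚ × ℚ) // x ∈ openBox t} => closedBox t.1)
    (fun t t' => ⟨⟨t.1 ∪ t'.1, fun p hp => (Finset.mem_union.1 hp).elim (t.2 p) (t'.2 p)⟩,
      fun _ hy p hp => hy p (Finset.mem_union_left _ hp),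
      fun _ hy p hp => hy p (Finset.mem_union_right _ hp)⟩)
    (fun t => isClosed_closedBox t.1) (U := U) fun y hy => hU.mem_nhds (h (hfib y hy))
  exact ⟨t.1, t.2, ht⟩

theorem mk_finset_box_le {lam : Cardinal.{u}} (hlam : ℵ₀ ≤ lam) {S : Set C(X, ℝ)} (hS : #S ≤ lam) :
    #(Finset (S × ℚ × ℚ)) ≤ lam := by
  have h : #(S × ℚ × ℚ) ≤ lam := by
    simp only [mk_prod, Cardinal.mkRat, lift_aleph0, aleph0_mul_aleph0, Cardinal.lift_uzero]
    exact mul_le_of_le hlam hS hlam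
  cases finite_or_infinite (S × ℚ × ℚ)
  · exact (lt_aleph0_of_finite _).le.trans hlam
  · rwa [mk_finset_of_infinite]

/-- A compact space with a point-separating set of at most `lam` functions has weight at most
`lam`. -/
theorem weight_le_of_separating [CompactSpace X] {lam : Cardinal.{u}} (hlam : ℵ₀ ≤ lam)
    {S : Set C(X, ℝ)} (hS : #S ≤ lam) (hsep : ∀ x, fiber S x ⊆ {x}) :
    ∃ B : Set (Set X), TopologicalSpace.IsTopologicalBasis B ∧ #B ≤ lam := by
  refine ⟨range fun t : Finset (S × ℚ × ℚ) => openBox t, ?_,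
    mk_range_le.trans (mk_finset_box_le hlam hS)⟩
  refine TopologicalSpace.isTopologicalBasis_of_isOpen_of_nhds ?_ fun x U hx hU => ?_
  · rintro _ ⟨t, rfl⟩
    exact isOpen_openBox t
  · obtain ⟨t, hxt, ht⟩ := exists_closedBox_subset hU
      ((hsep x).trans (singleton_subset_iff.2 hx))
    exact ⟨_, ⟨t, rfl⟩, hxt, (openBox_subset_closedBox t).trans ht⟩

/-- If the functions of `S` define a light map (all components of its fibres are degenerate),
then the weight is bounded by the size of `S` and the Suslinian number. -/
theorem weight_le_of_light [CompactSpace X] [T2Space X] [PreconnectedSpace X]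
    {lam : Cardinal.{u}} (hlam : ℵ₀ ≤ lam)
    (hκ : ∀ 𝒞 : Set (Set X), IsDisjointContinuumFamily 𝒞 → #𝒞 ≤ lam)
    {S : Set C(X, ℝ)} (hS : #S ≤ lam)
    (hlight : ∀ x, ¬ (connectedComponentIn (fiber S x) x).Nontrivial) :
    ∃ B : Set (Set X), TopologicalSpace.IsTopologicalBasis B ∧ #B ≤ lam := by
  let comps : Finset (S × ℚ × ℚ) → Set (Set X) := fun t =>
    {K : Set X | ∃ x, K = connectedComponentIn (closedBox t) x ∧ K.Nontrivial}
  let 𝒦 : Set (Set X) := ⋃ t, comps t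
  have h𝒦 : #𝒦 ≤ lam := (mk_iUnion_le _).trans (mul_le_of_le hlam (mk_finset_box_le hlam hS)
    (ciSup_le' fun t => hκ _ (isDisjointContinuumFamily_components (isClosed_closedBox t))))
  have hclosed : ∀ K ∈ 𝒦, IsClosed K := by
    intro K hK
    obtain ⟨t, x, rfl, -⟩ := mem_iUnion.1 hK
    exact isClosed_connectedComponentIn (isClosed_closedBox t) x
  -- One Urysohn function per disjoint pair of box components; adding these to `S` will separate
  -- points.
  have hsep : ∀ p : 𝒦 × 𝒦, ∃ g : C(X, ℝ), Disjoint p.1.1 p.2.1 →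
      EqOn g 0 p.1.1 ∧ EqOn g 1 p.2.1 := by
    rintro ⟨⟨K, hK⟩, ⟨L, hL⟩⟩
    by_cases h : Disjoint K L
    · obtain ⟨g, h0, h1, -⟩ := exists_continuous_zero_one_of_isClosed (hclosed K hK)
        (hclosed L hL) h
      exact ⟨g, fun _ => ⟨h0, h1⟩⟩
    · exact ⟨0, fun h' => absurd h' h⟩
  choose u hu using hsep
  refine weight_le_of_separating hlam (S := S ∪ range u) ?_ fun x y hy => ?_
  · refine (mk_union_le _ _).trans (add_le_of_le hlam hS (mk_range_le.trans ?_))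
    rw [mk_prod, Cardinal.lift_id]
    exact mul_le_of_le hlam h𝒦 h𝒦
  by_contra hyx
  have hyS : y ∈ fiber S x := fun g hg => hy g (Or.inl hg)
  have hxS := mem_fiber_self S x
  have hGc := isClosed_fiber S x
  have : CompactSpace (fiber S x) := isCompact_iff_compactSpace.1 hGc.isCompact
  -- Lightness puts `x` and `y` in different components of their common fibre, so a clopen part of
  -- the fibre separates them.
  have hnot : (⟨y, hyS⟩ : fiber S x) ∉ connectedComponent (⟨x, hxS⟩ : fiber S x) := fun h =>
    hlight x ⟨y, by
      rw [connectedComponentIn_eq_image hxS]; exact mem_image_of_mem _ h, x,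
      mem_connectedComponentIn hxS, hyx⟩
  rw [connectedComponent_eq_iInter_isClopen, mem_iInter, not_forall] at hnot
  obtain ⟨⟨Z, hZ, hxZ⟩, hyZ⟩ := hnot
  obtain ⟨U, V, hU, hV, hZU, hZV, hUV⟩ := normal_separation
    (hGc.isClosedEmbedding_subtypeVal.isClosedMap _ hZ.1)
    (hGc.isClosedEmbedding_subtypeVal.isClosedMap _ hZ.compl.1)
    ((disjoint_image_iff Subtype.val_injective).2 disjoint_compl_right)
  have hxU : x ∈ U := hZU ⟨_, hxZ, rfl⟩
  have hyV : y ∈ V := hZV ⟨⟨y, hyS⟩, hyZ, rfl⟩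
  obtain ⟨t, hxt, ht⟩ := exists_closedBox_subset (S := S) (x := x) (hU.union hV) fun z hz => by
    by_cases h : (⟨z, hz⟩ : fiber S x) ∈ Z
    · exact Or.inl (hZU ⟨_, h, rfl⟩)
    · exact Or.inr (hZV ⟨_, h, rfl⟩)
  have hyt : y ∈ openBox t := fun p hp => by
    rw [hyS p.1.1 p.1.2]
    exact hxt p hp
  have hint : ∀ z ∈ openBox t, z ∈ interior (closedBox t) := fun z hz =>
    interior_maximal (openBox_subset_closedBox t) (isOpen_openBox t) hz
  -- Otherwise the disjoint open sets `U` and `V` would disconnect `X`. Properness makes the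
  -- components of the box through `x` and `y` non-degenerate, hence members of `𝒦`.
  have hne : closedBox t ≠ Set.univ := by
    intro h
    rw [h] at ht
    exact disjoint_left.1 hUV (isPreconnected_univ.subset_left_of_subset_union hU hV hUV ht
      ⟨x, mem_univ x, hxU⟩ (mem_univ y)) hyV
  have hxc := nontrivial_connectedComponentIn (isClosed_closedBox t) hne (hint x hxt)
  have hyc := nontrivial_connectedComponentIn (isClosed_closedBox t) hne (hint y hyt)
  have hxm := mem_connectedComponentIn (interior_subset (hint x hxt))
  have hym := mem_connectedComponentIn (interior_subset (hint y hyt))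
  have hKU : connectedComponentIn (closedBox t) x ⊆ U :=
    isPreconnected_connectedComponentIn.subset_left_of_subset_union hU hV hUV
      ((connectedComponentIn_subset _ _).trans ht) ⟨x, hxm, hxU⟩
  have hKV : connectedComponentIn (closedBox t) y ⊆ V :=
    isPreconnected_connectedComponentIn.subset_right_of_subset_union hU hV hUV
      ((connectedComponentIn_subset _ _).trans ht) ⟨y, hym, hyV⟩
  let p : 𝒦 × 𝒦 := (⟨_, mem_iUnion.2 ⟨t, x, rfl, hxc⟩⟩, ⟨_, mem_iUnion.2 ⟨t, y, rfl, hyc⟩⟩)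
  obtain ⟨h0, h1⟩ := hu p (hUV.mono hKU hKV)
  have hEq := hy (u p) (Or.inr ⟨p, rfl⟩)
  rw [h0 hxm, h1 hym] at hEq
  exact one_ne_zero hEq

end Light

/-! ### Transfinite splitting of fibre components -/

section Stages

variable {X : Type u} [TopologicalSpace X]

/-- The component of `x` in its fibre under the functions in `S`: a fibre of the monotone part of
the diagonal product of `S`. -/
def node (S : Set C(X, ℝ)) (x : X) : Set X := connectedComponentIn (fiber S x) x

theorem mem_node (S : Set C(X, ℝ)) (x : X) : x ∈ node S x :=
  mem_connectedComponentIn (mem_fiber_self S x)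

theorem node_eq_of_mem {S : Set C(X, ℝ)} {x y : X} (h : y ∈ node S x) : node S x = node S y := by
  rw [node, node, connectedComponentIn_eq h,
    fiber_eq_of_mem (connectedComponentIn_subset _ _ h)]

theorem node_anti {S S' : Set C(X, ℝ)} (h : S ⊆ S') (x : X) : node S' x ⊆ node S x :=
  connectedComponentIn_mono x (fiber_anti h x)

/-- The non-degenerate components of the fibres defined by `S`. -/
def nodes (S : Set C(X, ℝ)) : Set (Set X) := {K | ∃ x, K = node S x ∧ K.Nontrivial}

theorem eq_node_of_mem {S : Set C(X, ℝ)} {K : Set X} (hK : K ∈ nodes S) {x : X} (hx : x ∈ K) :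
    K = node S x := by
  obtain ⟨y, rfl, -⟩ := hK
  exact node_eq_of_mem hx

theorem nontrivial_of_mem_nodes {S : Set C(X, ℝ)} {K : Set X} (hK : K ∈ nodes S) :
    K.Nontrivial := by
  obtain ⟨_, _, h⟩ := hK
  exact h

theorem isPreconnected_of_mem_nodes {S : Set C(X, ℝ)} {K : Set X} (hK : K ∈ nodes S) :
    IsPreconnected K := by
  obtain ⟨x, rfl, -⟩ := hK
  exact isPreconnected_connectedComponentIn

theorem isCompact_of_mem_nodes [CompactSpace X] {S : Set C(X, ℝ)} {K : Set X}
    (hK : K ∈ nodes S) : IsCompact K := by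
  obtain ⟨x, rfl, -⟩ := hK
  exact (isClosed_connectedComponentIn (isClosed_fiber S x) x).isCompact

theorem isDisjointContinuumFamily_nodes [CompactSpace X] (S : Set C(X, ℝ)) :
    IsDisjointContinuumFamily (nodes S) where
  isCompact _ hK := isCompact_of_mem_nodes hK
  isConnected _ hK := ⟨(nontrivial_of_mem_nodes hK).nonempty, isPreconnected_of_mem_nodes hK⟩
  nontrivial _ hK := nontrivial_of_mem_nodes hK
  pairwiseDisjoint _ hK _ hL hne := disjoint_left.2 fun _ hx hy =>
    hne ((eq_node_of_mem hK hx).trans (eq_node_of_mem hL hy).symm)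

open Classical in
/-- A continuous function that is not constant on `K`, if there is one. -/
noncomputable def splitFun (K : Set X) : C(X, ℝ) :=
  if h : ∃ g : C(X, ℝ), ∃ x ∈ K, ∃ y ∈ K, g x ≠ g y then h.choose else 0

theorem splitFun_spec [CompactSpace X] [T2Space X] {K : Set X} (hK : K.Nontrivial) :
    ∃ x ∈ K, ∃ y ∈ K, splitFun K x ≠ splitFun K y := by
  have h : ∃ g : C(X, ℝ), ∃ x ∈ K, ∃ y ∈ K, g x ≠ g y := by
    obtain ⟨x, hx, y, hy, hxy⟩ := hK
    obtain ⟨g, h0, h1, -⟩ := exists_continuous_zero_one_of_isClosed (isClosed_singleton (x := x))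
      (isClosed_singleton (x := y)) (disjoint_singleton.2 hxy)
    refine ⟨g, x, hx, y, hy, ?_⟩
    rw [h0 rfl, h1 rfl]
    exact zero_ne_one
  rw [splitFun, dif_pos h]
  exact h.choose_spec

/-- The functions that split the non-degenerate components of the fibres of `S`. -/
noncomputable def splitSet (S : Set C(X, ℝ)) : Set C(X, ℝ) := splitFun '' nodes S

theorem mk_splitSet_le [CompactSpace X] {κ : Cardinal.{u}}
    (hκ : ∀ 𝒞 : Set (Set X), IsDisjointContinuumFamily 𝒞 → #𝒞 ≤ κ) (S : Set C(X, ℝ)) :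
    #(splitSet S) ≤ κ :=
  mk_image_le.trans (hκ _ (isDisjointContinuumFamily_nodes S))

/-- The splitting function of the old node belongs to `S'`, so it is constant on the new node but
not on the old one. -/
theorem node_ssubset [CompactSpace X] [T2Space X] {S S' : Set C(X, ℝ)} (h : S ⊆ S')
    (hs : splitSet S ⊆ S') {x : X} (hx : (node S x).Nontrivial) : node S' x ⊂ node S x := by
  refine ⟨node_anti h x, fun hsub => ?_⟩
  obtain ⟨y, hy, z, hz, hne⟩ := splitFun_spec hx
  have hmem : splitFun (node S x) ∈ S' := hs (mem_image_of_mem _ ⟨x, rfl, hx⟩)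
  exact hne ((connectedComponentIn_subset _ _ (hsub hy) _ hmem).trans
    (connectedComponentIn_subset _ _ (hsub hz) _ hmem).symm)

variable {I : Type u} [LinearOrder I] [WellFoundedLT I]

/-- The transfinite sequence of function sets that successively split all non-degenerate fibre
components. -/
noncomputable def stage (X : Type u) [TopologicalSpace X] {I : Type u} [LinearOrder I]
    [WellFoundedLT I] : I → Set C(X, ℝ) :=
  (wellFounded_lt (α := I)).fix fun i ih => ⋃ j : Iio i, splitSet (ih j.1 j.2)

theorem stage_eq (i : I) : stage X i = ⋃ j : Iio i, splitSet (stage X j.1) :=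
  (wellFounded_lt (α := I)).fix_eq _ i

theorem stage_mono {i j : I} (h : i ≤ j) : stage X i ⊆ stage X j := by
  rw [stage_eq i, stage_eq j]
  exact iUnion_subset fun k => subset_iUnion_of_subset ⟨k.1, k.2.trans_le h⟩ subset_rfl

theorem splitSet_stage_subset {i j : I} (h : i < j) : splitSet (stage X i) ⊆ stage X j := by
  rw [stage_eq j]
  exact subset_iUnion_of_subset ⟨i, h⟩ subset_rfl

theorem mk_stage_le [CompactSpace X] {κ : Cardinal.{u}} (hκ₀ : ℵ₀ ≤ κ)
    (hκ : ∀ 𝒞 : Set (Set X), IsDisjointContinuumFamily 𝒞 → #𝒞 ≤ κ) {i : I}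
    (hi : #(Iio i) ≤ κ) : #(stage X i) ≤ κ := by
  rw [stage_eq]
  exact (mk_iUnion_le _).trans (mul_le_of_le hκ₀ hi (ciSup_le' fun j => mk_splitSet_le hκ _))

theorem node_stage_ssubset [CompactSpace X] [T2Space X] {i j : I} (h : i < j) {x : X}
    (hx : (node (stage X i) x).Nontrivial) : node (stage X j) x ⊂ node (stage X i) x :=
  node_ssubset (stage_mono h.le) (splitSet_stage_subset h) hx

/-- The functions of all stages together define a light map if there are more than `κ` stages. -/
theorem weight_le_of_lt_mk [CompactSpace X] [T2Space X] [PreconnectedSpace X]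
    {κ : Cardinal.{u}} (hκ₀ : ℵ₀ ≤ κ)
    (hκ : ∀ 𝒞 : Set (Set X), IsDisjointContinuumFamily 𝒞 → #𝒞 ≤ κ) (hI : κ < #I) :
    ∃ B : Set (Set X), TopologicalSpace.IsTopologicalBasis B ∧ #B ≤ #I := by
  have hle : ∀ i : I, stage X i ⊆ ⋃ j : I, splitSet (stage X j) := fun i => by
    rw [stage_eq]
    exact iUnion_subset fun j => subset_iUnion_of_subset j.1 subset_rfl
  refine weight_le_of_light (hκ₀.trans hI.le) (fun 𝒞 h => (hκ 𝒞 h).trans hI.le)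
    (S := ⋃ i : I, splitSet (stage X i)) ?_ fun x hx => ?_
  · exact (mk_iUnion_le _).trans (mul_le_of_le (hκ₀.trans hI.le) le_rfl
      (ciSup_le' fun j => (mk_splitSet_le hκ _).trans hI.le))
  · have hn : ∀ i : I, (node (stage X i) x).Nontrivial := fun i =>
      hx.mono (node_anti (hle i) x)
    exact hI.not_ge (mk_le_of_strictAnti hκ₀ hκ (fun i : I => node (stage X i) x)
      (fun i j hij => node_stage_ssubset hij (hn i))
      (fun i => isCompact_of_mem_nodes ⟨x, rfl, hn i⟩)
      (fun i => isPreconnected_connectedComponentIn) hn)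

end Stages

/-! ### The tree of nodes: levels, height, chains, antichains -/

section StageTree

variable {X : Type u} [TopologicalSpace X] {I : Type u} [LinearOrder I] [WellFoundedLT I]

/-- The tree of all non-degenerate fibre components of all stages. -/
def StageTree (X : Type u) [TopologicalSpace X] (I : Type u) [LinearOrder I]
    [WellFoundedLT I] : Type u :=
  {K : Set X // ∃ i : I, K ∈ nodes (stage X i)}

/-- The tree is ordered by reverse inclusion. -/
instance : PartialOrder (StageTree X I) :=
  PartialOrder.lift (fun K => OrderDual.toDual K.1) fun _ _ h => Subtype.ext h

namespace StageTree

theorem le_iff {K L : StageTree X I} : K ≤ L ↔ L.1 ⊆ K.1 := Iff.rfl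

theorem lt_iff {K L : StageTree X I} : K < L ↔ L.1 ⊂ K.1 := Iff.rfl

/-- The stage at which a node appears. -/
noncomputable def level (K : StageTree X I) : I := K.2.choose

theorem mem_nodes (K : StageTree X I) : K.1 ∈ nodes (stage X K.level) := K.2.choose_spec

theorem eq_node (K : StageTree X I) {x : X} (hx : x ∈ K.1) : K.1 = node (stage X K.level) x :=
  eq_node_of_mem K.mem_nodes hx

theorem nontrivial (K : StageTree X I) : K.1.Nontrivial := nontrivial_of_mem_nodes K.mem_nodes

theorem eq_of_level_eq {K L : StageTree X I} {x : X} (hK : x ∈ K.1) (hL : x ∈ L.1)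
    (h : K.level = L.level) : K = L :=
  Subtype.ext (by rw [K.eq_node hK, L.eq_node hL, h])

variable [CompactSpace X] [T2Space X]

theorem lt_of_level_lt {K L : StageTree X I} {x : X} (hK : x ∈ K.1) (hL : x ∈ L.1)
    (h : K.level < L.level) : K < L := by
  rw [lt_iff, K.eq_node hK, L.eq_node hL]
  exact node_stage_ssubset h (K.eq_node hK ▸ K.nontrivial)

theorem level_lt_iff {K L : StageTree X I} {x : X} (hK : x ∈ K.1) (hL : x ∈ L.1) :
    K.level < L.level ↔ K < L := by
  refine ⟨lt_of_level_lt hK hL, fun h => ?_⟩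
  rcases lt_trichotomy K.level L.level with h' | h' | h'
  · exact h'
  · exact absurd (eq_of_level_eq hK hL h') h.ne
  · exact absurd (lt_of_level_lt hL hK h') h.not_gt

theorem level_lt_level {K L : StageTree X I} (h : K < L) : K.level < L.level := by
  obtain ⟨x, hx⟩ := L.nontrivial.nonempty
  exact (level_lt_iff (h.le hx) hx).2 h

/-- A node shrinks strictly at every later stage, so no set is a node of two stages and the choice
in `level` is forced. -/
theorem level_eq {K : StageTree X I} {i : I} (h : K.1 ∈ nodes (stage X i)) : K.level = i := by
  obtain ⟨x, hx⟩ := K.nontrivial.nonempty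
  have h₁ := K.eq_node hx
  have h₂ := eq_node_of_mem h hx
  rcases lt_trichotomy K.level i with h' | h' | h'
  · exact absurd (h₂.symm.trans h₁) (node_stage_ssubset h' (h₁ ▸ K.nontrivial)).ne
  · exact h'
  · exact absurd (h₁.symm.trans h₂) (node_stage_ssubset h' (h₂ ▸ K.nontrivial)).ne

/-- The predecessors of a node correspond to the stages before its level. -/
theorem nonempty_relIso (K : StageTree X I) :
    Nonempty ((fun a b : Iio K => a < b) ≃r (fun a b : Iio K.level => a < b)) := by
  obtain ⟨x, hx⟩ := K.nontrivial.nonempty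
  have hmem : ∀ L : Iio K, x ∈ L.1.1 := fun L => le_iff.1 (le_of_lt L.2) hx
  let f : (fun a b : Iio K => a < b) ↪r (fun a b : Iio K.level => a < b) :=
    { toFun := fun L => ⟨L.1.level, level_lt_level L.2⟩
      inj' := fun L M h =>
        Subtype.ext (eq_of_level_eq (hmem L) (hmem M) (congrArg Subtype.val h))
      map_rel_iff' := fun {L M} => level_lt_iff (hmem L) (hmem M) }
  refine ⟨RelIso.ofSurjective f ?_⟩
  rintro ⟨j, hj⟩
  -- Surjectivity: the stage-`j` component through `x` contains `K`, so it is non-degenerate and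
  -- counts as a node.
  have hsub : K.1 ⊆ node (stage X j) x := by
    rw [K.eq_node hx]
    exact node_anti (stage_mono (le_of_lt hj)) x
  have hn : node (stage X j) x ∈ nodes (stage X j) := ⟨x, rfl, K.nontrivial.mono hsub⟩
  let L : StageTree X I := ⟨_, j, hn⟩
  have hL : L.level = j := level_eq hn
  exact ⟨⟨L, lt_of_level_lt (mem_node _ x) hx (hL ▸ hj)⟩, Subtype.ext hL⟩

instance : IsTree (StageTree X I) where
  isWellOrder_Iio K := by
    obtain ⟨e⟩ := nonempty_relIso K
    exact e.toRelEmbedding.isWellOrder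

theorem nodeHeight_eq (K : StageTree X I) :
    nodeHeight K = typein ((· < ·) : I → I → Prop) K.level := by
  rw [nodeHeight, type_eq.2 (nonempty_relIso K)]
  exact type_Iio_lt K.level

theorem treeHeight_eq (h : ∀ i : I, (nodes (stage X i)).Nonempty) :
    treeHeight (StageTree X I) = type ((· < ·) : I → I → Prop) := by
  apply le_antisymm
  · refine csInf_le' fun K => ?_
    rw [nodeHeight_eq]
    exact typein_lt_type _ _
  · refine le_csInf ⟨_, fun K => (nodeHeight_eq K).trans_lt (typein_lt_type _ _)⟩ fun α hα => ?_
    by_contra! hlt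
    obtain ⟨i, hi⟩ := (typein ((· < ·) : I → I → Prop)).mem_range_of_rel_top hlt
    obtain ⟨K, hK⟩ := h i
    let L : StageTree X I := ⟨K, i, hK⟩
    have hL : nodeHeight L < α := hα L
    rw [nodeHeight_eq, level_eq hK, hi] at hL
    exact hL.false

/-- Nodes that share a point are comparable, so an antichain is a disjoint family of continua. -/
theorem mk_antichain_le {κ : Cardinal.{u}}
    (hκ : ∀ 𝒞 : Set (Set X), IsDisjointContinuumFamily 𝒞 → #𝒞 ≤ κ) {A : Set (StageTree X I)}
    (hA : IsAntichain (· ≤ ·) A) : #A ≤ κ := by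
  rw [← mk_image_eq (s := A) (Subtype.val_injective :
    Function.Injective (Subtype.val : StageTree X I → Set X))]
  refine hκ _ ⟨?_, ?_, ?_, ?_⟩
  · rintro _ ⟨K, -, rfl⟩
    exact isCompact_of_mem_nodes K.mem_nodes
  · rintro _ ⟨K, -, rfl⟩
    exact ⟨K.nontrivial.nonempty, isPreconnected_of_mem_nodes K.mem_nodes⟩
  · rintro _ ⟨K, -, rfl⟩
    exact K.nontrivial
  · rintro _ ⟨K, hK, rfl⟩ _ ⟨L, hL, rfl⟩ hne
    refine disjoint_left.2 fun x hxK hxL => ?_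
    have hKL : K ≠ L := fun h => hne (h ▸ rfl)
    rcases lt_trichotomy K.level L.level with h | h | h
    · exact hA hK hL hKL (lt_of_level_lt hxK hxL h).le
    · exact hKL (eq_of_level_eq hxK hxL h)
    · exact hA hL hK hKL.symm (lt_of_level_lt hxL hxK h).le

theorem mk_chain_le {κ : Cardinal.{u}} (hκ₀ : ℵ₀ ≤ κ)
    (hκ : ∀ 𝒞 : Set (Set X), IsDisjointContinuumFamily 𝒞 → #𝒞 ≤ κ) {C : Set (StageTree X I)}
    (hC : IsChain (· ≤ ·) C) : #C ≤ κ := by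
  have hmeet : ∀ K ∈ C, ∀ L ∈ C, ∃ x, x ∈ K.1 ∧ x ∈ L.1 := by
    intro K hK L hL
    rcases hC.total hK hL with h | h
    · obtain ⟨x, hx⟩ := L.nontrivial.nonempty
      exact ⟨x, h hx, hx⟩
    · obtain ⟨x, hx⟩ := K.nontrivial.nonempty
      exact ⟨x, hx, h hx⟩
  have hinj : InjOn level C := fun K hK L hL h => by
    obtain ⟨x, hxK, hxL⟩ := hmeet K hK L hL
    exact eq_of_level_eq hxK hxL h
  rw [← mk_image_eq_of_injOn _ _ hinj]
  -- Indexing the chain by its levels makes it a well-ordered strictly decreasing family.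
  choose K hKC hK using fun j : level '' C => j.2
  exact mk_le_of_strictAnti hκ₀ hκ (fun j => (K j).1) (fun i j hij => by
      obtain ⟨x, hxi, hxj⟩ := hmeet _ (hKC i) _ (hKC j)
      exact lt_of_level_lt hxi hxj (by rw [hK, hK]; exact hij))
    (fun j => isCompact_of_mem_nodes (K j).mem_nodes)
    (fun j => isPreconnected_of_mem_nodes (K j).mem_nodes) (fun j => (K j).nontrivial)

end StageTree

end StageTree

/-! ### Weight of subspaces and of degenerate spaces -/

section Weight

theorem weight_le_of_isEmbedding {X Y : Type u} [TopologicalSpace X] [TopologicalSpace Y]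
    {f : X → Y} (hf : IsEmbedding f) {lam : Cardinal.{u}}
    (h : ∃ B : Set (Set Y), TopologicalSpace.IsTopologicalBasis B ∧ #B ≤ lam) :
    weight X ≤ lam := by
  obtain ⟨B, hB, hle⟩ := h
  exact (csInf_le' ⟨_, hB.isInducing hf.isInducing, rfl⟩ : weight X ≤ _).trans
    (mk_image_le.trans hle)

theorem weight_of_isEmpty (X : Type u) [TopologicalSpace X] [IsEmpty X] : weight X = 0 :=
  le_antisymm (csInf_le' ⟨∅, TopologicalSpace.isTopologicalBasis_of_isOpen_of_nhds (by simp)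
    fun x => isEmptyElim x, Cardinal.mk_eq_zero _⟩) (zero_le)

theorem weight_le_one (X : Type u) [TopologicalSpace X] [Subsingleton X] : weight X ≤ 1 :=
  csInf_le' ⟨{Set.univ}, TopologicalSpace.isTopologicalBasis_of_isOpen_of_nhds (by simp)
    fun x U hx _ => ⟨_, rfl, mem_univ x, fun y _ => Subsingleton.elim x y ▸ hx⟩, mk_singleton _⟩

end Weight

/-! ### The two weight bounds for continua -/

section Continua

variable {Y : Type u} [TopologicalSpace Y] [CompactSpace Y] [T2Space Y] [PreconnectedSpace Y]
  {κ : Cardinal.{u}}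

theorem exists_basis_mk_le_succ (hκ₀ : ℵ₀ ≤ κ)
    (hκ : ∀ 𝒞 : Set (Set Y), IsDisjointContinuumFamily 𝒞 → #𝒞 ≤ κ) :
    ∃ B : Set (Set Y), TopologicalSpace.IsTopologicalBasis B ∧ #B ≤ Order.succ κ := by
  have h := weight_le_of_lt_mk (I := (Order.succ κ).ord.ToType) hκ₀ hκ
    (by rw [mk_ord_toType]; exact Order.lt_succ κ)
  rwa [mk_ord_toType] at h

theorem exists_basis_mk_le (hκ₀ : ℵ₀ ≤ κ)
    (hκ : ∀ 𝒞 : Set (Set Y), IsDisjointContinuumFamily 𝒞 → #𝒞 ≤ κ)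
    (hS : ¬ ExistsSuslinTree (Order.succ κ)) :
    ∃ B : Set (Set Y), TopologicalSpace.IsTopologicalBasis B ∧ #B ≤ κ := by
  let I := (Order.succ κ).ord.ToType
  by_cases h : ∀ i : I, (nodes (stage Y i)).Nonempty
  · refine absurd ⟨StageTree Y I, inferInstance, inferInstance, ?_, fun C hC => ?_,
      fun A hA => ?_⟩ hS
    · rw [StageTree.treeHeight_eq h]
      exact type_toType _
    · exact ((StageTree.mk_chain_le hκ₀ hκ hC).trans_lt (Order.lt_succ κ)).ne
    · exact ((StageTree.mk_antichain_le hκ hA).trans_lt (Order.lt_succ κ)).ne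
  · push Not at h
    obtain ⟨i, hi⟩ := h
    -- An index below the initial ordinal of `κ⁺` has at most `κ` predecessors, so this node-free
    -- stage has at most `κ` functions.
    have hlt := mk_Iio_lt i (by rw [mk_ord_toType, type_toType])
    rw [mk_ord_toType] at hlt
    refine weight_le_of_light hκ₀ hκ (S := stage Y i)
      (mk_stage_le hκ₀ hκ (Order.lt_succ_iff.1 hlt)) fun x hx => ?_
    exact eq_empty_iff_forall_notMem.1 hi _ ⟨x, rfl, hx⟩

end Continua

end SuslinianNumber

theorem mainTheorem1 (X : Type u) [TopologicalSpace X] [T35Space X] :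
    SuslinianNumber.weight X ≤ Order.succ (SuslinianNumber.Sln X) ∧
      (Cardinal.mk X ≠ 1 →
        ¬ SuslinianNumber.ExistsSuslinTree (Order.succ (SuslinianNumber.Sln X)) →
          SuslinianNumber.weight X ≤ SuslinianNumber.Sln X) := by
  obtain ⟨Y, _, hY, ⟨f, hf⟩, hYX⟩ := csInf_mem (SuslinianNumber.slnSet_nonempty X)
  change _ = SuslinianNumber.Sln X at hYX
  have := hY.compactSpace
  have := hY.t2Space
  have := hY.connectedSpace
  -- A degenerate `Y` does not make `κ` infinite. Here `X` has at most one point; the first bound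
  -- follows from `1 = succ 0`, and excluding one-point spaces leaves only the empty space, of
  -- weight zero.
  rcases subsingleton_or_nontrivial Y with _ | _
  · have : Subsingleton X := hf.injective.subsingleton
    refine ⟨(SuslinianNumber.weight_le_one X).trans ?_, fun h1 _ => ?_⟩
    · rw [← Cardinal.succ_zero]
      exact Order.succ_le_succ (zero_le)
    · rcases isEmpty_or_nonempty X with _ | _
      · rw [SuslinianNumber.weight_of_isEmpty]
        exact zero_le
      · exact absurd (le_antisymm (Cardinal.le_one_iff_subsingleton.2 this)
          (Cardinal.one_le_iff_ne_zero.2 (Cardinal.mk_ne_zero X))) h1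
  · have hκ : ∀ 𝒞 : Set (Set Y), SuslinianNumber.IsDisjointContinuumFamily 𝒞 →
        #𝒞 ≤ SuslinianNumber.Sln X := fun 𝒞 h𝒞 =>
      hYX ▸ le_ciSup (SuslinianNumber.bddAbove_continuumSln Y) ⟨𝒞, h𝒞⟩
    have hκ₀ := SuslinianNumber.aleph0_le_of_nontrivial hκ
    exact ⟨SuslinianNumber.weight_le_of_isEmbedding hf
        (SuslinianNumber.exists_basis_mk_le_succ hκ₀ hκ),
      fun _ hS => SuslinianNumber.weight_le_of_isEmbedding hf
        (SuslinianNumber.exists_basis_mk_le hκ₀ hκ hS)⟩
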